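/- Let $n$ be a positive integer. An $n$-move on an (unoriented) link in $S^3$ replaces two parallel strands of a diagram of the link by $n$ half twists of these two strands; two links are $n$-move equivalent if, up to ambient isotopy, they are transformed into each other by a finite sequence of $n$-moves and their inverses. A trivial link is a link with a diagram consisting of disjoint circles without crossings. The 2-parallel of a link is obtained by replacing each component by two parallel copies of it with linking number $0$ (with respect to parallel orientations). Theorem. For every odd prime $p$, the closure of the $5$-braid $(\sigma_1\sigma_2\sigma_3\sigma_4)^{10}$ is not $p$-move equivalent to a trivial link (with any number of components), and the 2-parallel of the Borromean rings is not $p$-move equivalent to a trivial link (with any number of components). -/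

import Mathlib

/-! Links are presented by unoriented plane diagrams in general position with respect to a height
function: the diagram is cut by horizontal lines into slices, each of which consists of one
elementary piece (a minimum, a maximum or a crossing) and otherwise vertical strands.  Ambient
isotopy is generated by plane isotopy and the Reidemeister moves, written for such diagrams. -/

/-- The elementary pieces, read upwards: a local minimum, a local maximum, and a crossing.  In
`cross true` the strand going from the lower left to the upper right is the over-strand, in
`cross false` it is the under-strand. -/
inductive Piece : Type
  | cup : Piece
  | cap : Piece
  | cross (s : Bool) : Piece
deriving DecidableEq

/-- Number of endpoints on the lower edge of a piece. -/
def Piece.bot : Piece → ℕ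
  | .cup => 0
  | .cap => 2
  | .cross _ => 2

/-- Number of endpoints on the upper edge of a piece. -/
def Piece.top : Piece → ℕ
  | .cup => 2
  | .cap => 0
  | .cross _ => 2

/-- A slice of a diagram: `pos` vertical strands, then the piece, then further vertical strands
(as many as there are). -/
structure Slice : Type where
  piece : Piece
  pos : ℕ
deriving DecidableEq

/-- A minimum whose two ends are the strands number `i` and `i + 1` (strands are counted from the
left, starting at `0`). -/
def cup (i : ℕ) : Slice := ⟨.cup, i⟩

/-- A maximum joining the strands number `i` and `i + 1`. -/
def cap (i : ℕ) : Slice := ⟨.cap, i⟩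

/-- A crossing of the strands number `i` and `i + 1`. -/
def cross (i : ℕ) (s : Bool) : Slice := ⟨.cross s, i⟩

/-- The list of slices `w`, read from bottom to top, is a tangle diagram with `n` endpoints at the
bottom and `m` endpoints at the top. -/
def IsTangle : ℕ → List Slice → ℕ → Prop
  | n, [], m => n = m
  | n, l :: w, m =>
      l.pos + l.piece.bot ≤ n ∧ IsTangle (n - l.piece.bot + l.piece.top) w m

/-- An unoriented link diagram: a tangle diagram without endpoints. -/
structure LinkDiagram : Type where
  word : List Slice
  isTangle : IsTangle 0 word 0

/-- The local moves generating isotopy of unoriented tangles: plane isotopies (`exchange`,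
`zigzag_*` and `slide_*`) and the Reidemeister moves.  A move applies to a link diagram only if
both sides are link diagrams, so the number of strands around it need not be recorded. -/
inductive IsotopyMove : List Slice → List Slice → Prop
  /-- exchanging the heights of two pieces that lie beside each other -/
  | exchange (a b : Piece) (i k : ℕ) :
      IsotopyMove [⟨a, i⟩, ⟨b, i + a.top + k⟩] [⟨b, i + a.bot + k⟩, ⟨a, i⟩]
  /-- cancelling a minimum against the maximum to its right, resp. to its left -/
  | zigzag_right (i : ℕ) : IsotopyMove [cup i, cap (i + 1)] []
  | zigzag_left (i : ℕ) : IsotopyMove [cup (i + 1), cap i] []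
  /-- moving a strand that crosses one leg of an extremum to the other leg -/
  | slide_cup (i : ℕ) (s : Bool) :
      IsotopyMove [cup i, cross (i + 1) s] [cup (i + 1), cross i (!s)]
  | slide_cap (i : ℕ) (s : Bool) :
      IsotopyMove [cross i s, cap (i + 1)] [cross (i + 1) (!s), cap i]
  /-- first Reidemeister move -/
  | reidemeister_one_cup (i : ℕ) (s : Bool) : IsotopyMove [cup i, cross i s] [cup i]
  | reidemeister_one_cap (i : ℕ) (s : Bool) : IsotopyMove [cross i s, cap i] [cap i]
  /-- second Reidemeister move -/
  | reidemeister_two (i : ℕ) (s : Bool) : IsotopyMove [cross i s, cross i (!s)] []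
  /-- third Reidemeister move -/
  | reidemeister_three (i : ℕ) (s : Bool) :
      IsotopyMove [cross i s, cross (i + 1) s, cross i s]
        [cross (i + 1) s, cross i s, cross (i + 1) s]

/-- Two parallel strands are replaced by `n` half twists of these strands, in one of the two
directions. -/
inductive TwistMove (n : ℕ) : List Slice → List Slice → Prop
  | twist (i : ℕ) (s : Bool) : TwistMove n [] (List.replicate n (cross i s))

/-- `D'` arises from the link diagram `D` by applying the local move `R` to a part of it. -/
def LinkDiagram.Step (R : List Slice → List Slice → Prop) (D D' : LinkDiagram) : Prop :=
  ∃ u v l r : List Slice, R l r ∧ D.word = u ++ l ++ v ∧ D'.word = u ++ r ++ v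

/-- Links: link diagrams up to isotopy (`Quot` passes to the generated equivalence relation). -/
def Link : Type := Quot (LinkDiagram.Step IsotopyMove)

/-- The link represented by a diagram. -/
def LinkDiagram.toLink (D : LinkDiagram) : Link := Quot.mk _ D

/-- `L'` arises from the link `L` by inserting `n` half twists in two parallel strands of some
diagram of `L`. -/
def NMove (n : ℕ) (L L' : Link) : Prop :=
  ∃ D D' : LinkDiagram, D.toLink = L ∧ D'.toLink = L' ∧ D.Step (TwistMove n) D'

/-- Two links are `n`-move equivalent if they are related by a finite sequence of `n`-moves and
inverses of `n`-moves. -/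
def NMoveEquivalent (n : ℕ) (L L' : Link) : Prop := Relation.EqvGen (NMove n) L L'

theorem IsTangle.append {n k m : ℕ} {u v : List Slice} (hu : IsTangle n u k)
    (hv : IsTangle k v m) : IsTangle n (u ++ v) m := by
  induction u generalizing n with
  | nil => cases hu; exact hv
  | cons l u ih => exact ⟨hu.1, ih hu.2⟩

/-- `m` circles without crossings. -/
def trivialWord : ℕ → List Slice
  | 0 => []
  | m + 1 => cup 0 :: cap 0 :: trivialWord m

theorem isTangle_trivialWord (m : ℕ) : IsTangle 0 (trivialWord m) 0 := by
  induction m with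
  | zero => rfl
  | succ m ih => exact ⟨le_rfl, le_rfl, ih⟩

/-- The trivial link with `m` components. -/
def trivialLink (m : ℕ) : Link := LinkDiagram.toLink ⟨trivialWord m, isTangle_trivialWord m⟩

/-- A link is trivial if it is a trivial link with some number of components. -/
def Link.IsTrivial (L : Link) : Prop := ∃ m : ℕ, L = trivialLink m

/-- A word in the standard generators of the braid group on `n + 1` strands and their inverses:
the letter `(i, true)` stands for `σ_{i+1}` and `(i, false)` for its inverse. -/
abbrev BraidWord (n : ℕ) : Type := List (Fin n × Bool)

/-- The braid diagram of a braid word. -/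
def BraidWord.slices {n : ℕ} (b : BraidWord n) : List Slice :=
  b.map fun x => cross x.1 x.2

/-- The nested minima `cup 0, …, cup (n - 1)`, joining strand `i` to strand `2 * n - 1 - i`. -/
def nestedCups : ℕ → List Slice
  | 0 => []
  | n + 1 => nestedCups n ++ [cup n]

/-- The nested maxima `cap (n - 1), …, cap 0`, joining strand `i` to strand `2 * n - 1 - i`. -/
def nestedCaps : ℕ → List Slice
  | 0 => []
  | n + 1 => cap n :: nestedCaps n

theorem isTangle_nestedCups (n : ℕ) : IsTangle 0 (nestedCups n) (2 * n) := by
  induction n with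
  | zero => rfl
  | succ n ih =>
    refine ih.append ⟨?_, ?_⟩
    · simp only [cup, Piece.bot]; omega
    · simp only [cup, Piece.bot, Piece.top, IsTangle]; omega

theorem isTangle_nestedCaps (n : ℕ) : IsTangle (2 * n) (nestedCaps n) 0 := by
  induction n with
  | zero => rfl
  | succ n ih =>
    refine ⟨?_, ?_⟩
    · simp only [cap, Piece.bot]; omega
    · have h : 2 * (n + 1) - (cap n).piece.bot + (cap n).piece.top = 2 * n := by
        simp only [cap, Piece.bot, Piece.top]; omega
      rw [h]; exact ih

theorem BraidWord.isTangle_slices {n m : ℕ} (b : BraidWord n) (h : n + 1 ≤ m) :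
    IsTangle m b.slices m := by
  induction b with
  | nil => rfl
  | cons x b ih =>
    have hx := x.1.isLt
    refine ⟨?_, ?_⟩
    · simp only [cross, Piece.bot]; omega
    · have e : m - (cross x.1 x.2).piece.bot + (cross x.1 x.2).piece.top = m := by
        simp only [cross, Piece.bot, Piece.top]; omega
      rw [e]; exact ih

/-- The closure of a braid on `n + 1` strands: the braid occupies the strands `0, …, n`, and the
closing arcs run to its right. -/
def BraidWord.closure {n : ℕ} (b : BraidWord n) : LinkDiagram where
  word := nestedCups (n + 1) ++ b.slices ++ nestedCaps (n + 1)
  isTangle := ((isTangle_nestedCups (n + 1)).append (b.isTangle_slices (by omega))).append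
    (isTangle_nestedCaps (n + 1))

/-- Doubling every strand of a slice in the plane: strand `i` becomes the strands `2 * i` and
`2 * i + 1`. -/
def Slice.double : Slice → List Slice
  | ⟨.cup, i⟩ => [cup (2 * i), cup (2 * i + 1)]
  | ⟨.cap, i⟩ => [cap (2 * i + 1), cap (2 * i)]
  | ⟨.cross s, i⟩ =>
      [cross (2 * i + 1) s, cross (2 * i) s, cross (2 * i + 2) s, cross (2 * i + 1) s]

theorem IsTangle.double {n m : ℕ} {w : List Slice} (h : IsTangle n w m) :
    IsTangle (2 * n) (w.flatMap Slice.double) (2 * m) := by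
  induction w generalizing n with
  | nil => cases h; rfl
  | cons l w ih =>
    obtain ⟨h₁, h₂⟩ := h
    rw [List.flatMap_cons]
    refine IsTangle.append (k := 2 * (n - l.piece.bot + l.piece.top)) ?_ (ih h₂)
    obtain ⟨p, i⟩ := l
    cases p <;>
      simp only [Slice.double, IsTangle, cup, cap, cross, Piece.bot, Piece.top] at h₁ ⊢ <;> omega

/-- The blackboard 2-parallel of a link diagram: every component is replaced by two copies of it
that are parallel in the plane.  When no component of the diagram crosses itself, the two copies
of each component have linking number zero, so that this is the (untwisted) 2-parallel. -/
def LinkDiagram.twoParallel (D : LinkDiagram) : LinkDiagram where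
  word := D.word.flatMap Slice.double
  isTangle := D.isTangle.double

/-- The 5-braid `(σ₁ σ₂ σ₃ σ₄) ^ 10`. -/
def fiveBraid : BraidWord 4 :=
  (List.replicate 10 [(0, true), (1, true), (2, true), (3, true)]).flatten

/-- The standard diagram of the Borromean rings, the closure of the 3-braid `(σ₁ σ₂⁻¹) ^ 3`.  This
is a pure braid, so its three strands close up to the three components, and none of them crosses
itself. -/
def borromeanRings : LinkDiagram :=
  BraidWord.closure (n := 2) (List.replicate 3 [(0, true), (1, false)]).flatten

/-! Colorings of link diagrams by involutory quandles.  The number of colorings by a finite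
involutory quandle in which `p` half twists act trivially is invariant under `p`-moves. -/

/-! For a finite involutory quandle in which `p` half twists act as the identity, the number of
colorings of a link is unchanged by isotopy and by `p`-moves
(`Link.numColorings_eq_of_nMoveEquivalent`). The trivial link with `m` components has `|X| ^ m`
colorings, and the closure of a braid has as many as the braid fixes tuples of colors
(`numColorings_closure`).

Two quandles are played against each other. Both braids, the second being the doubled Borromean
braid, fix all tuples over the point reflections of `ZMod p`, so a trivial link equivalent to the
closure must have as many components as the braid has strands. Every tuple over any other admissible
quandle would then have to be fixed as well (`not_nMoveEquivalent_of_braidAct`). The quandle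
`cubicOp` on `(ZMod p) ^ 4` refutes this: its cubic term is mild enough for `p` half twists to stay
trivial (`twistTrivial_cubicOp`), yet each braid moves an explicit tuple by 4, up to sign, in a last
coordinate, which is nonzero modulo every odd prime. -/

/-- The operation of an involutory quandle: `op x` is the reflection in the point `x`. -/
structure IsKei {X : Type*} (op : X → X → X) : Prop where
  idem : ∀ x, op x x = x
  invol : ∀ x y, op x (op x y) = y
  distrib : ∀ x y z, op x (op y z) = op (op x y) (op x z)

/-- The effect of a crossing on the colors of two strands. -/
def crossPair {X : Type*} (op : X → X → X) (s : Bool) (c : X × X) : X × X :=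
  bif s then (op c.1 c.2, c.1) else (c.2, op c.2 c.1)

/-- The effect of a crossing of the strands `i` and `i + 1` on a sequence of colors. -/
def crossAt {X : Type*} (op : X → X → X) (i : ℕ) (s : Bool) (c : ℕ → X) : ℕ → X := fun j =>
  if j = i then (crossPair op s (c i, c (i + 1))).1
  else if j = i + 1 then (crossPair op s (c i, c (i + 1))).2 else c j

/-- Insert two strands of color `x` at position `i`. -/
def insertPair {X : Type*} (i : ℕ) (x : X) (c : ℕ → X) : ℕ → X := fun j =>
  if j < i then c j else if j < i + 2 then x else c (j - 2)

/-- Remove the strands `i` and `i + 1`. -/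
def removePair {X : Type*} (i : ℕ) (c : ℕ → X) : ℕ → X := fun j =>
  if j < i then c j else c (j + 2)

/-! ### Coloring counts and isotopy invariance. -/

section Colorings

variable {X : Type*}

/-- This and the next identities say that pieces acting on disjoint strands commute; the offset 2
appears where a minimum or maximum on the left shifts the numbering. They yield
`numColorings_exchange`. -/
theorem insertPair_insertPair (i k : ℕ) (x y : X) (c : ℕ → X) :
    insertPair (i + 2 + k) y (insertPair i x c) = insertPair i x (insertPair (i + k) y c) := by
  ext j
  simp only [insertPair]
  grind

theorem removePair_insertPair (i k : ℕ) (x : X) (c : ℕ → X) :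
    removePair (i + 2 + k) (insertPair i x c) = insertPair i x (removePair (i + k) c) := by
  ext j
  simp only [insertPair, removePair]
  grind

theorem crossAt_insertPair (op : X → X → X) (i k : ℕ) (s : Bool) (x : X) (c : ℕ → X) :
    crossAt op (i + 2 + k) s (insertPair i x c) = insertPair i x (crossAt op (i + k) s c) := by
  ext j
  simp only [insertPair, crossAt]
  grind

theorem insertPair_removePair (i k : ℕ) (x : X) (c : ℕ → X) :
    insertPair (i + k) x (removePair i c) = removePair i (insertPair (i + 2 + k) x c) := by
  ext j
  simp only [insertPair, removePair]
  grind

theorem removePair_removePair (i k : ℕ) (c : ℕ → X) :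
    removePair (i + k) (removePair i c) = removePair i (removePair (i + 2 + k) c) := by
  ext j
  simp only [removePair]
  grind

theorem crossAt_removePair (op : X → X → X) (i k : ℕ) (s : Bool) (c : ℕ → X) :
    crossAt op (i + k) s (removePair i c) = removePair i (crossAt op (i + 2 + k) s c) := by
  ext j
  simp only [removePair, crossAt]
  grind

theorem insertPair_crossAt (op : X → X → X) (i k : ℕ) (s : Bool) (x : X) (c : ℕ → X) :
    insertPair (i + 2 + k) x (crossAt op i s c) = crossAt op i s (insertPair (i + 2 + k) x c) := by
  ext j
  simp only [insertPair, crossAt]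
  grind

theorem removePair_crossAt (op : X → X → X) (i k : ℕ) (s : Bool) (c : ℕ → X) :
    removePair (i + 2 + k) (crossAt op i s c) = crossAt op i s (removePair (i + 2 + k) c) := by
  ext j
  simp only [removePair, crossAt]
  grind

theorem crossAt_crossAt (op : X → X → X) (i k : ℕ) (s t : Bool) (c : ℕ → X) :
    crossAt op (i + 2 + k) t (crossAt op i s c) = crossAt op i s (crossAt op (i + 2 + k) t c) := by
  ext j
  simp only [crossAt]
  grind

theorem insertPair_apply_add (i k : ℕ) (x : X) (c : ℕ → X) :
    insertPair i x c (i + 2 + k) = c (i + k) := by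
  simp only [insertPair]
  grind

theorem insertPair_apply_lt {i j : ℕ} (h : j < i) (x : X) (c : ℕ → X) :
    insertPair i x c j = c j := if_pos h

theorem removePair_apply_add (i k : ℕ) (c : ℕ → X) :
    removePair i c (i + k) = c (i + 2 + k) := by
  simp only [removePair]
  grind

theorem removePair_apply_lt {i j : ℕ} (h : j < i) (c : ℕ → X) :
    removePair i c j = c j := if_pos h

theorem crossAt_apply_of_ne (op : X → X → X) {i j : ℕ} (s : Bool) (c : ℕ → X) (h : j ≠ i)
    (h' : j ≠ i + 1) : crossAt op i s c j = c j := by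
  simp only [crossAt, if_neg h, if_neg h']

theorem IsKei.op_eq_iff {op : X → X → X} (h : IsKei op) (x y z : X) :
    op x y = z ↔ y = op x z :=
  ⟨fun e => by rw [← e, h.invol], fun e => by rw [e, h.invol]⟩

theorem crossAt_left (op : X → X → X) (i : ℕ) (s : Bool) (c : ℕ → X) :
    crossAt op i s c i = (crossPair op s (c i, c (i + 1))).1 := if_pos rfl

theorem crossAt_right (op : X → X → X) (i : ℕ) (s : Bool) (c : ℕ → X) :
    crossAt op i s c (i + 1) = (crossPair op s (c i, c (i + 1))).2 := by simp [crossAt]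

theorem removePair_crossAt_self (op : X → X → X) (i : ℕ) (s : Bool) (c : ℕ → X) :
    removePair i (crossAt op i s c) = removePair i c := by
  ext j
  simp only [removePair, crossAt]
  grind

variable [Fintype X] [DecidableEq X]

/-- The number of colorings of a stack of slices that extend the colors `c` of the strands at the
bottom.  Only finitely many of the strands recorded in `c` belong to the diagram; the others are
carried along as if they ran vertically. -/
def numColorings (op : X → X → X) : List Slice → (ℕ → X) → ℕ
  | [], _ => 1
  | ⟨.cup, i⟩ :: w, c => ∑ x, numColorings op w (insertPair i x c)
  | ⟨.cap, i⟩ :: w, c => if c i = c (i + 1) then numColorings op w (removePair i c) else 0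
  | ⟨.cross s, i⟩ :: w, c => numColorings op w (crossAt op i s c)

theorem numColorings_cup (op : X → X → X) (i : ℕ) (w : List Slice) (c : ℕ → X) :
    numColorings op (cup i :: w) c = ∑ x, numColorings op w (insertPair i x c) := rfl

theorem numColorings_cap (op : X → X → X) (i : ℕ) (w : List Slice) (c : ℕ → X) :
    numColorings op (cap i :: w) c =
      if c i = c (i + 1) then numColorings op w (removePair i c) else 0 := rfl

theorem numColorings_cross (op : X → X → X) (i : ℕ) (s : Bool) (w : List Slice) (c : ℕ → X) :
    numColorings op (cross i s :: w) c = numColorings op w (crossAt op i s c) := rfl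

/-- Slices below a local move only alter the colors that enter it, so it suffices to compare the two
sides for all bottom colors. -/
theorem numColorings_append_congr (op : X → X → X) {l r : List Slice}
    (h : ∀ c, numColorings op l c = numColorings op r c) (u : List Slice) (c : ℕ → X) :
    numColorings op (u ++ l) c = numColorings op (u ++ r) c := by
  induction u generalizing c with
  | nil => exact h c
  | cons a u ih =>
    obtain ⟨a, i⟩ := a
    cases a <;> simp only [List.cons_append, numColorings, ih]

theorem numColorings_exchange (op : X → X → X) (a b : Piece) (i k : ℕ) (v : List Slice)
    (c : ℕ → X) :
    numColorings op (⟨a, i⟩ :: ⟨b, i + a.top + k⟩ :: v) c =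
      numColorings op (⟨b, i + a.bot + k⟩ :: ⟨a, i⟩ :: v) c := by
  rcases a with _ | _ | s <;> rcases b with _ | _ | t <;>
    simp only [numColorings, Piece.top, Piece.bot, Nat.add_zero]
  · rw [Finset.sum_comm]
    simp only [insertPair_insertPair]
  · simp only [removePair_insertPair, insertPair_apply_add]
    simp only [add_assoc (i + 2) k 1, insertPair_apply_add, ← add_assoc i k 1]
    by_cases hc : c (i + k) = c (i + k + 1) <;> simp [hc]
  · simp only [crossAt_insertPair]
  · simp only [insertPair_removePair,
      insertPair_apply_lt (show i < i + 2 + k by omega),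
      insertPair_apply_lt (show i + 1 < i + 2 + k by omega)]
    split_ifs <;> simp
  · simp only [removePair_removePair, removePair_apply_add,
      removePair_apply_lt (show i < i + 2 + k by omega),
      removePair_apply_lt (show i + 1 < i + 2 + k by omega)]
    simp only [add_assoc i k 1, removePair_apply_add, ← add_assoc (i + 2) k 1]
    split_ifs <;> rfl
  · simp only [crossAt_removePair, crossAt_apply_of_ne op t c (show i ≠ i + 2 + k by omega)
      (by omega), crossAt_apply_of_ne op t c (show i + 1 ≠ i + 2 + k by omega) (by omega)]
  · simp only [insertPair_crossAt]
  · simp only [removePair_crossAt, crossAt_apply_of_ne op s c (show i + 2 + k ≠ i by omega)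
      (by omega), crossAt_apply_of_ne op s c (show i + 2 + k + 1 ≠ i by omega) (by omega)]
    rfl
  · rw [crossAt_crossAt]

theorem numColorings_isotopyMove {op : X → X → X} (h : IsKei op) {l r : List Slice}
    (hlr : IsotopyMove l r) (v : List Slice) (c : ℕ → X) :
    numColorings op (l ++ v) c = numColorings op (r ++ v) c := by
  rcases hlr with ⟨a, b, i, k⟩ | i | i | ⟨i, s⟩ | ⟨i, s⟩ | ⟨i, s⟩ | ⟨i, s⟩ | ⟨i, s⟩ | ⟨i, s⟩ <;>
    simp only [List.cons_append, List.nil_append]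
  · exact numColorings_exchange op a b i k v c
  · simp only [numColorings_cup, numColorings_cap]
    have h₁ : ∀ x : X, insertPair i x c (i + 1) = x := by simp [insertPair]
    have h₂ : ∀ x : X, insertPair i x c (i + 1 + 1) = c i := fun x => insertPair_apply_add i 0 x c
    simp only [h₁, h₂, Finset.sum_ite_eq', Finset.mem_univ, if_true]
    congr 1
    ext j
    simp only [insertPair, removePair]
    grind
  · simp only [numColorings_cup, numColorings_cap]
    have h₁ : ∀ x : X, insertPair (i + 1) x c i = c i := by simp [insertPair]
    have h₂ : ∀ x : X, insertPair (i + 1) x c (i + 1) = x := by simp [insertPair]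
    simp only [h₁, h₂, Finset.sum_ite_eq, Finset.mem_univ, if_true]
    congr 1
    ext j
    simp only [insertPair, removePair]
    grind
  · simp only [numColorings_cup, numColorings_cross]
    cases s
    -- Here the arc of the minimum passes under the strand colored `c i`, so the colors of the
    -- minimum in the two diagrams differ by the reflection in `c i`.
    · refine Fintype.sum_equiv ⟨op (c i), op (c i), h.invol _, h.invol _⟩ _ _ fun x => congrArg _ ?_
      have hx := h.invol (c i) x
      ext j
      simp only [insertPair, crossAt, crossPair, cond, Bool.not_false, Equiv.coe_fn_mk]
      grind
    · refine Finset.sum_congr rfl fun x _ => congrArg _ ?_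
      ext j
      simp only [insertPair, crossAt, crossPair, cond, Bool.not_true]
      grind
  · simp only [numColorings_cross, numColorings_cap]
    rw [crossAt_right, crossAt_left,
      crossAt_apply_of_ne op s c (show i + 1 + 1 ≠ i by omega) (by omega),
      crossAt_apply_of_ne op (!s) c (show i ≠ i + 1 by omega) (by omega)]
    have hc : (crossPair op s (c i, c (i + 1))).2 = c (i + 1 + 1) ↔
        c i = (crossPair op (!s) (c (i + 1), c (i + 1 + 1))).1 := by
      cases s
      · exact h.op_eq_iff _ _ _
      · rfl
    refine ite_congr (propext hc) (fun hi => congrArg _ ?_) fun _ => rfl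
    ext j
    cases s <;>
      simp only [removePair, crossAt, crossPair, cond, Bool.not_true, Bool.not_false] at hi ⊢ <;>
      grind
  · simp only [numColorings_cup, numColorings_cross]
    refine Finset.sum_congr rfl fun x _ => congrArg _ ?_
    have hx := h.idem x
    ext j
    cases s <;> simp only [insertPair, crossAt, crossPair, cond] <;> grind
  · simp only [numColorings_cross, numColorings_cap]
    rw [removePair_crossAt_self]
    refine if_congr ?_ rfl rfl
    have h₁ := h.idem (c i)
    have h₂ := h.idem (c (i + 1))
    have h₃ := h.op_eq_iff (c i) (c (i + 1)) (c i)
    have h₄ := h.op_eq_iff (c (i + 1)) (c i) (c (i + 1))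
    rw [crossAt_left, crossAt_right]
    cases s <;> simp only [crossPair, cond] <;> grind
  · simp only [numColorings_cross]
    congr 1
    have h₁ := h.invol (c i) (c (i + 1))
    have h₂ := h.invol (c (i + 1)) (c i)
    ext j
    cases s <;> simp only [crossAt, crossPair, cond, Bool.not_true, Bool.not_false] <;> grind
  · simp only [numColorings_cross]
    congr 1
    have h₁ := h.distrib (c i) (c (i + 1)) (c (i + 2))
    have h₂ := h.distrib (c (i + 2)) (c (i + 1)) (c i)
    ext j
    cases s <;> simp only [crossAt, crossPair, cond] <;> grind

end Colorings

/-! ### Invariance under twist moves. -/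

section Invariance

variable {X : Type*}

theorem crossAt_iterate (op : X → X → X) (i : ℕ) (s : Bool) (n : ℕ) (c : ℕ → X) :
    (crossAt op i s)^[n] c = fun j =>
      if j = i then ((crossPair op s)^[n] (c i, c (i + 1))).1
      else if j = i + 1 then ((crossPair op s)^[n] (c i, c (i + 1))).2 else c j := by
  induction n with
  | zero =>
    ext j
    simp only [Function.iterate_zero, id]
    grind
  | succ n ih =>
    ext j
    simp only [Function.iterate_succ', Function.comp, ih]
    simp only [crossAt]
    grind

/-- `n` half twists, in either direction, do not change the colors of two strands. -/
def TwistTrivial (op : X → X → X) (n : ℕ) : Prop := ∀ s, (crossPair op s)^[n] = id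

/-- Half twists in opposite directions are inverse to each other, so one direction suffices. -/
theorem IsKei.twistTrivial {op : X → X → X} (h : IsKei op) {n : ℕ}
    (hn : ∀ a b, (crossPair op true)^[n] (a, b) = (a, b)) : TwistTrivial op n := by
  have hinv : Function.LeftInverse (crossPair op false) (crossPair op true) := fun c => by
    simp [crossPair, h.invol]
  rintro (_ | _)
  · ext1 c
    have := hinv.iterate n c
    rwa [hn] at this
  · exact funext fun c => hn c.1 c.2

variable [Fintype X] [DecidableEq X]

theorem numColorings_replicate_cross (op : X → X → X) (n i : ℕ) (s : Bool) (v : List Slice)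
    (c : ℕ → X) :
    numColorings op (List.replicate n (cross i s) ++ v) c =
      numColorings op v ((crossAt op i s)^[n] c) := by
  induction n generalizing c with
  | zero => rfl
  | succ n ih =>
    rw [List.replicate_succ, List.cons_append, numColorings_cross, ih, Function.iterate_succ_apply]

theorem numColorings_twistMove {op : X → X → X} {n : ℕ} (h : TwistTrivial op n) {l r : List Slice}
    (hlr : TwistMove n l r) (v : List Slice) (c : ℕ → X) :
    numColorings op (l ++ v) c = numColorings op (r ++ v) c := by
  obtain ⟨i, s⟩ := hlr
  rw [numColorings_replicate_cross, crossAt_iterate, h s, List.nil_append]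
  congr 1
  ext j
  simp only [id]
  grind

theorem numColorings_step {op : X → X → X} {R : List Slice → List Slice → Prop}
    (hR : ∀ l r, R l r → ∀ v c, numColorings op (l ++ v) c = numColorings op (r ++ v) c)
    {D D' : LinkDiagram} (h : D.Step R D') (c : ℕ → X) :
    numColorings op D.word c = numColorings op D'.word c := by
  obtain ⟨u, v, l, r, hlr, hD, hD'⟩ := h
  rw [hD, hD', List.append_assoc, List.append_assoc]
  exact numColorings_append_congr op (hR l r hlr v) u c

/-- The number of colorings of a link by a finite involutory quandle. -/
def Link.numColorings {op : X → X → X} (h : IsKei op) (c : ℕ → X) : Link → ℕ :=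
  Quot.lift (fun D => _root_.numColorings op D.word c) fun _ _ hD =>
    numColorings_step (fun _ _ => numColorings_isotopyMove h) hD c

theorem Link.numColorings_eq_of_nMoveEquivalent {op : X → X → X} (h : IsKei op) {n : ℕ}
    (hn : TwistTrivial op n) (c : ℕ → X) {L L' : Link} (hL : NMoveEquivalent n L L') :
    L.numColorings h c = L'.numColorings h c := by
  induction hL with
  | rel L L' hL =>
    obtain ⟨D, D', rfl, rfl, hD⟩ := hL
    exact numColorings_step (fun _ _ => numColorings_twistMove hn) hD c
  | refl => rfl
  | symm _ _ _ ih => exact ih.symm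
  | trans _ _ _ _ _ ih ih' => exact ih.trans ih'

theorem Link.numColorings_trivialLink {op : X → X → X} (h : IsKei op) (c : ℕ → X) (m : ℕ) :
    (trivialLink m).numColorings h c = Fintype.card X ^ m := by
  change _root_.numColorings op (trivialWord m) c = _
  induction m generalizing c with
  | zero => rfl
  | succ m ih =>
    simp [trivialWord, numColorings_cup, numColorings_cap, insertPair, ih, pow_succ']

end Invariance

/-! ### Colorings of braid closures. -/

section Closure

variable {X : Type*} {n : ℕ}

/-- The colors `x` read forwards, then `y` read backwards, then `c`. -/
def glueColors (x y : Fin n → X) (c : ℕ → X) : ℕ → X := fun j =>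
  if h : j < n then x ⟨j, h⟩
  else if h' : j < 2 * n then y ⟨2 * n - 1 - j, by omega⟩ else c (j - 2 * n)

/-- The action of a generator of the braid group or its inverse on tuples of colors. -/
def letterAct (op : X → X → X) (l : Fin n × Bool) (x : Fin (n + 1) → X) : Fin (n + 1) → X :=
  fun j =>
    if j = l.1.castSucc then (crossPair op l.2 (x l.1.castSucc, x l.1.succ)).1
    else if j = l.1.succ then (crossPair op l.2 (x l.1.castSucc, x l.1.succ)).2 else x j

/-- The action of a braid word on tuples of colors. -/
def braidAct (op : X → X → X) (b : BraidWord n) (x : Fin (n + 1) → X) : Fin (n + 1) → X :=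
  b.foldl (fun y l => letterAct op l y) x

theorem letterAct_comp {Y : Type*} {op : X → X → X} {op' : Y → Y → Y} {f : X → Y}
    (hf : ∀ a b, f (op a b) = op' (f a) (f b)) (l : Fin n × Bool) (x : Fin (n + 1) → X) :
    letterAct op' l (f ∘ x) = f ∘ letterAct op l x := by
  obtain ⟨i, s⟩ := l
  ext j
  cases s <;> simp only [letterAct, crossPair, cond, Function.comp, ← hf, apply_ite f]

/-- Applied to reduction modulo `p`, this lets one integer computation serve all primes. -/
theorem braidAct_comp {Y : Type*} {op : X → X → X} {op' : Y → Y → Y} {f : X → Y}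
    (hf : ∀ a b, f (op a b) = op' (f a) (f b)) (b : BraidWord n) (x : Fin (n + 1) → X) :
    braidAct op' b (f ∘ x) = f ∘ braidAct op b x := by
  induction b generalizing x with
  | nil => rfl
  | cons l b ih =>
    change braidAct op' b (letterAct op' l (f ∘ x)) = _
    rw [letterAct_comp hf, ih]
    rfl

theorem braidAct_flatten_replicate (op : X → X → X) (k : ℕ) (b : BraidWord n) :
    braidAct op (List.replicate k b).flatten = (braidAct op b)^[k] := by
  induction k with
  | zero => rfl
  | succ k ih =>
    ext1 x
    rw [Function.iterate_succ_apply, ← ih, List.replicate_succ, List.flatten_cons]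
    exact List.foldl_append

theorem insertPair_glueColors (x y : Fin n → X) (a : X) (c : ℕ → X) :
    insertPair n a (glueColors x y c) =
      glueColors (Fin.snoc (α := fun _ => X) x a) (Fin.snoc (α := fun _ => X) y a) c := by
  ext j
  simp only [insertPair, glueColors, Fin.snoc, Fin.castLT, cast_eq]
  grind

theorem removePair_glueColors (x y : Fin (n + 1) → X) (c : ℕ → X) :
    removePair n (glueColors x y c) =
      glueColors (Fin.init (α := fun _ => X) x) (Fin.init (α := fun _ => X) y) c := by
  ext j
  simp only [removePair, glueColors, Fin.init, Fin.castSucc, Fin.castAdd, Fin.castLE]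
  grind

theorem crossAt_glueColors (op : X → X → X) (l : Fin n × Bool) (x y : Fin (n + 1) → X)
    (c : ℕ → X) :
    crossAt op l.1 l.2 (glueColors x y c) = glueColors (letterAct op l x) y c := by
  obtain ⟨⟨i, hi⟩, s⟩ := l
  ext j
  simp only [crossAt, glueColors, letterAct, Fin.castSucc, Fin.castAdd, Fin.castLE, Fin.succ,
    Fin.mk.injEq]
  grind

variable [Fintype X] [DecidableEq X]

theorem numColorings_nestedCups (op : X → X → X) (n : ℕ) (v : List Slice) (c : ℕ → X) :
    numColorings op (nestedCups n ++ v) c =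
      ∑ x : Fin n → X, numColorings op v (glueColors x x c) := by
  induction n generalizing v with
  | zero =>
    rw [Fintype.sum_unique]
    exact congrArg _ (funext fun j => by simp [glueColors])
  | succ n ih =>
    rw [nestedCups, List.append_assoc, ih, ← (Fin.snocEquiv fun _ => X).sum_comp,
      Fintype.sum_prod_type_right]
    refine Finset.sum_congr rfl fun x _ => ?_
    rw [List.singleton_append, numColorings_cup]
    exact Finset.sum_congr rfl fun a _ => congrArg _ (insertPair_glueColors x x a c)

theorem numColorings_nestedCaps (op : X → X → X) (n : ℕ) (x y : Fin n → X) (c : ℕ → X) :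
    numColorings op (nestedCaps n) (glueColors x y c) = if x = y then 1 else 0 := by
  induction n with
  | zero => simp [nestedCaps, numColorings, Subsingleton.elim x y]
  | succ n ih =>
    have h₁ : glueColors x y c n = x (Fin.last n) := by simp [glueColors, Fin.last]
    have h₂ : glueColors x y c (n + 1) = y (Fin.last n) := by
      simp only [glueColors, Fin.last]
      grind
    rw [nestedCaps, numColorings_cap, h₁, h₂, removePair_glueColors, ih, ← ite_and]
    refine if_congr ⟨fun h => ?_, fun h => by simp [h]⟩ rfl rfl
    rw [← Fin.snoc_init_self x, ← Fin.snoc_init_self y, h.1, h.2]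

theorem numColorings_slices (op : X → X → X) (b : BraidWord n) (x y : Fin (n + 1) → X)
    (v : List Slice) (c : ℕ → X) :
    numColorings op (b.slices ++ v) (glueColors x y c) =
      numColorings op v (glueColors (braidAct op b x) y c) := by
  induction b generalizing x with
  | nil => rfl
  | cons l b ih =>
    change numColorings op (cross l.1 l.2 :: (BraidWord.slices b ++ v)) _ = _
    rw [numColorings_cross, crossAt_glueColors, ih]
    rfl

/-- The colorings of a braid closure are the tuples of colors fixed by the braid. -/
theorem numColorings_closure (op : X → X → X) (b : BraidWord n) (c : ℕ → X) :
    numColorings op b.closure.word c =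
      (Finset.univ.filter fun x : Fin (n + 1) → X => braidAct op b x = x).card := by
  change numColorings op (nestedCups (n + 1) ++ b.slices ++ nestedCaps (n + 1)) c = _
  rw [List.append_assoc, numColorings_nestedCups, Finset.card_filter]
  simp only [numColorings_slices, numColorings_nestedCaps]

end Closure

/-! ### The obstruction from two quandles. -/

/-- If a braid fixes all tuples of one finite involutory quandle but not all tuples of another one,
then its closure cannot be reduced to a trivial link. -/
theorem not_nMoveEquivalent_of_braidAct {X Y : Type*} [Fintype X] [DecidableEq X] [Nontrivial X]
    [Fintype Y] [DecidableEq Y] {op : X → X → X} {op' : Y → Y → Y} (h : IsKei op)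
    (h' : IsKei op') {p : ℕ} (hp : TwistTrivial op p) (hp' : TwistTrivial op' p) {n : ℕ}
    {b : BraidWord n} (hb : ∀ x, braidAct op b x = x) (hb' : ∃ y, braidAct op' b y ≠ y) (T : Link)
    (hT : T.IsTrivial) : ¬ NMoveEquivalent p b.closure.toLink T := by
  intro hbT
  obtain ⟨m, rfl⟩ := hT
  obtain ⟨y, hy⟩ := hb'
  obtain ⟨x⟩ : Nonempty X := inferInstance
  have hX := Link.numColorings_eq_of_nMoveEquivalent h hp (fun _ => x) hbT
  have hY := Link.numColorings_eq_of_nMoveEquivalent h' hp' (fun _ => y 0) hbT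
  rw [Link.numColorings_trivialLink] at hX hY
  change numColorings op b.closure.word _ = _ at hX
  change numColorings op' b.closure.word _ = _ at hY
  rw [numColorings_closure] at hX hY
  -- The first quandle determines the number of components.
  have hm : n + 1 = m := by
    rw [Finset.filter_true_of_mem fun x _ => hb x, Finset.card_univ, Fintype.card_fun,
      Fintype.card_fin] at hX
    exact Nat.pow_right_injective Fintype.one_lt_card hX
  have : Fintype.card Y ^ m = (Finset.univ : Finset (Fin (n + 1) → Y)).card := by
    rw [Finset.card_univ, Fintype.card_fun, Fintype.card_fin, hm]
  rw [this, Finset.card_filter_eq_iff] at hY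
  exact hy (hY y (Finset.mem_univ y))

/-! ### The affine and cubic quandles. -/

/-- The involutory quandle of point reflections in a commutative ring. -/
def affineOp (R : Type*) [CommRing R] (x y : R) : R := 2 * x - y

theorem isKei_affineOp (R : Type*) [CommRing R] : IsKei (affineOp R) where
  idem x := by simp only [affineOp]; ring
  invol x y := by simp only [affineOp]; ring
  distrib x y z := by simp only [affineOp]; ring

/-- Half twists continue the arithmetic progression `b, a, 2a - b, …`, whose step dies after `p`
terms modulo `p`. -/
theorem crossPair_affineOp_iterate {R : Type*} [CommRing R] (a b : R) (n : ℕ) :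
    (crossPair (affineOp R) true)^[n] (a, b) = (a + n * (a - b), b + n * (a - b)) := by
  induction n with
  | zero => simp
  | succ n ih =>
    rw [Function.iterate_succ_apply', ih]
    simp only [crossPair, affineOp, cond, Nat.cast_succ]
    ext <;> ring

theorem twistTrivial_affineOp (p : ℕ) : TwistTrivial (affineOp (ZMod p)) p :=
  (isKei_affineOp _).twistTrivial fun a b => by simp [crossPair_affineOp_iterate]

/-- A deformation of the reflections in `R ^ 4` by a cubic term in the last coordinate. -/
def cubicOp (R : Type*) [CommRing R] (x y : R × R × R × R) : R × R × R × R :=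
  (2 * x.1 - y.1, 2 * x.2.1 - y.2.1, 2 * x.2.2.1 - y.2.2.1,
    2 * x.2.2.2 - y.2.2.2 + (x.1 * y.2.1 - x.2.1 * y.1) * (x.2.2.1 - y.2.2.1))

theorem isKei_cubicOp (R : Type*) [CommRing R] : IsKei (cubicOp R) where
  idem x := by simp only [cubicOp]; ext <;> ring
  invol x y := by simp only [cubicOp]; ext <;> ring
  distrib x y z := by simp only [cubicOp]; ext <;> ring

/-- The points of the orbit of `a` and `b` under half twists. -/
def cubicLine {R : Type*} [CommRing R] (a b : R × R × R × R) (n : ℕ) : R × R × R × R :=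
  b + (n : R) • (a - b) +
    (0, 0, 0, (n.choose 2 : R) * ((a.1 * b.2.1 - a.2.1 * b.1) * (a.2.2.1 - b.2.2.1)))

/-- Along the orbit, the determinant of the first two coordinates of consecutive points and their
difference in the third are constant. Hence so is the second difference of the last coordinate,
which produces the binomial coefficient. -/
theorem crossPair_cubicOp_iterate {R : Type*} [CommRing R] (a b : R × R × R × R) (n : ℕ) :
    (crossPair (cubicOp R) true)^[n] (a, b) = (cubicLine a b (n + 1), cubicLine a b n) := by
  induction n with
  | zero => simp [cubicLine]
  | succ n ih =>
    have h : ∀ k : ℕ, ((k + 1).choose 2 : R) = k + k.choose 2 := fun k => by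
      rw [Nat.choose_succ_succ' k 1, Nat.choose_one_right, Nat.cast_add]
    rw [Function.iterate_succ_apply', ih]
    simp only [crossPair, cond, Prod.mk.injEq, and_true]
    simp only [cubicLine, cubicOp, h, Nat.cast_succ, Prod.fst_add, Prod.snd_add, Prod.smul_fst,
      Prod.smul_snd, Prod.fst_sub, Prod.snd_sub, smul_eq_mul]
    ext <;> simp <;> ring

theorem twistTrivial_cubicOp {p : ℕ} (hp : p.Prime) (hodd : Odd p) :
    TwistTrivial (cubicOp (ZMod p)) p := by
  refine (isKei_cubicOp _).twistTrivial fun a b => ?_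
  have h2 : 2 < p := lt_of_le_of_ne hp.two_le fun h => by
    exact absurd (h ▸ hodd) (by decide)
  -- The cubic correction after `p` half twists vanishes because `p > 2` divides `p.choose 2`.
  have h : ((p.choose 2 : ℕ) : ZMod p) = 0 :=
    (ZMod.natCast_eq_zero_iff _ _).2 (hp.dvd_choose_self two_ne_zero h2)
  have h' : (((p + 1).choose 2 : ℕ) : ZMod p) = 0 := by
    rw [Nat.choose_succ_succ' p 1, Nat.choose_one_right, Nat.cast_add, h, ZMod.natCast_self,
      add_zero]
  rw [crossPair_cubicOp_iterate]
  simp [cubicLine, h, h']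

/-- Coordinatewise reduction of integer points. -/
def castPoint (R : Type*) [CommRing R] (x : ℤ × ℤ × ℤ × ℤ) : R × R × R × R :=
  (x.1, x.2.1, x.2.2.1, x.2.2.2)

theorem castPoint_cubicOp (R : Type*) [CommRing R] (x y : ℤ × ℤ × ℤ × ℤ) :
    castPoint R (cubicOp ℤ x y) = cubicOp R (castPoint R x) (castPoint R y) := by
  simp [castPoint, cubicOp]

/-- A braid that moves the last coordinate of an integer tuple by a power of two moves a tuple
modulo every odd prime. -/
theorem exists_braidAct_cubicOp_ne {p : ℕ} (hp : p.Prime) (hodd : Odd p) {n k : ℕ}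
    {b : BraidWord n} (x : Fin (n + 1) → ℤ × ℤ × ℤ × ℤ) (j : Fin (n + 1))
    (h : ((braidAct (cubicOp ℤ) b x j).2.2.2 - (x j).2.2.2).natAbs = 2 ^ k) :
    ∃ y, braidAct (cubicOp (ZMod p)) b y ≠ y := by
  refine ⟨castPoint (ZMod p) ∘ x, fun hx => ?_⟩
  rw [braidAct_comp (castPoint_cubicOp _)] at hx
  have hj : (((braidAct (cubicOp ℤ) b x j).2.2.2 - (x j).2.2.2 : ℤ) : ZMod p) = 0 := by
    rw [Int.cast_sub, sub_eq_zero]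
    exact congrArg (fun z => z.2.2.2) (congrFun hx j)
  rw [ZMod.intCast_zmod_eq_zero_iff_dvd _ _, Int.natCast_dvd, h] at hj
  have h2 := (Nat.prime_dvd_prime_iff_eq hp Nat.prime_two).1 (hp.dvd_of_dvd_pow hj)
  exact absurd (h2 ▸ hodd) (by decide)

/-! ### The 5-braid. -/

theorem braidAct_fiveBraid {X : Type*} (op : X → X → X) :
    braidAct op fiveBraid =
      (braidAct op [(0, true), (1, true), (2, true), (3, true)])^[10] :=
  braidAct_flatten_replicate op 10 _

theorem braidAct_fiveBraid_factor {X : Type*} (op : X → X → X) (a b c d e : X) :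
    braidAct op [(0, true), (1, true), (2, true), (3, true)] ![a, b, c, d, e] =
      ![op a b, op a c, op a d, op a e, a] := by
  ext j
  fin_cases j <;> rfl

theorem braidAct_fiveBraid_affineOp {R : Type*} [CommRing R] (x : Fin 5 → R) :
    braidAct (affineOp R) fiveBraid x = x := by
  -- The full twist acts as a point reflection whose center, the alternating sum, it preserves; its
  -- square is therefore the identity.
  have h : ∀ a b c d e : R, (braidAct (affineOp R) [(0, true), (1, true), (2, true), (3, true)])^[5]
      ![a, b, c, d, e] = let t := 2 * (a - b + c - d + e); ![t - a, t - b, t - c, t - d, t - e] := by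
    intro a b c d e
    simp only [Function.iterate_succ_apply, Function.iterate_zero, id, braidAct_fiveBraid_factor,
      affineOp]
    ext j
    fin_cases j <;> simp <;> ring
  have hx : x = ![x 0, x 1, x 2, x 3, x 4] := by
    ext j
    fin_cases j <;> rfl
  rw [braidAct_fiveBraid, Function.iterate_add _ 5 5, Function.comp_apply, hx, h, h]
  ext j
  fin_cases j <;> simp <;> ring

theorem exists_braidAct_fiveBraid_ne {p : ℕ} (hp : p.Prime) (hodd : Odd p) :
    ∃ y, braidAct (cubicOp (ZMod p)) fiveBraid y ≠ y := by
  -- The cubic term is fed by the first three coordinates, so three strands carry the corresponding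
  -- basis vectors and the others the origin.
  refine exists_braidAct_cubicOp_ne hp hodd (k := 2)
    ![(0, 0, 0, 0), (0, 0, 0, 0), (1, 0, 0, 0), (0, 1, 0, 0), (0, 0, 1, 0)] 0 ?_
  rw [braidAct_fiveBraid]
  simp only [Function.iterate_succ_apply, Function.iterate_zero, id, braidAct_fiveBraid_factor]
  norm_num [cubicOp]

/-! ### The 2-parallel of the Borromean rings. -/

/-- The 6-braid obtained from `(σ₁ σ₂⁻¹) ^ 3` by doubling the strands. -/
def doubledBorromeanBraid : BraidWord 5 :=
  (List.replicate 3 [(1, true), (0, true), (2, true), (1, true),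
    (3, false), (2, false), (4, false), (3, false)]).flatten

theorem borromeanRings_twoParallel : borromeanRings.twoParallel = doubledBorromeanBraid.closure := by
  -- Doubled nested extrema are again nested extrema, so the two words agree letter by letter.
  have h : borromeanRings.twoParallel.word = doubledBorromeanBraid.closure.word := by decide
  generalize borromeanRings.twoParallel = D at h
  generalize doubledBorromeanBraid.closure = D' at h
  cases D
  cases D'
  cases h
  rfl

theorem braidAct_doubledBorromeanBraid {X : Type*} (op : X → X → X) :
    braidAct op doubledBorromeanBraid =
      (braidAct op [(1, true), (0, true), (2, true), (1, true),
        (3, false), (2, false), (4, false), (3, false)])^[3] :=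
  braidAct_flatten_replicate op 3 _

theorem braidAct_doubledBorromeanBraid_factor {X : Type*} (op : X → X → X) (a b c d e f : X) :
    braidAct op [(1, true), (0, true), (2, true), (1, true),
        (3, false), (2, false), (4, false), (3, false)] ![a, b, c, d, e, f] =
      ![op a (op b c), op a (op b d), e, f, op f (op e a), op f (op e b)] := by
  ext j
  fin_cases j <;> rfl

/-- Passing under a doubled strand is a product of two reflections, hence a translation by twice the
difference of its colors, up to sign. The differences within the pairs are only permuted, and over
three rounds the translations of each pair cancel. -/
theorem braidAct_doubledBorromeanBraid_affineOp {R : Type*} [CommRing R] (x : Fin 6 → R) :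
    braidAct (affineOp R) doubledBorromeanBraid x = x := by
  have hx : x = ![x 0, x 1, x 2, x 3, x 4, x 5] := by
    ext j
    fin_cases j <;> rfl
  rw [braidAct_doubledBorromeanBraid, hx]
  simp only [Function.iterate_succ_apply, Function.iterate_zero, id,
    braidAct_doubledBorromeanBraid_factor, affineOp]
  ext j
  fin_cases j <;> simp <;> ring

theorem exists_braidAct_doubledBorromeanBraid_ne {p : ℕ} (hp : p.Prime) (hodd : Odd p) :
    ∃ y, braidAct (cubicOp (ZMod p)) doubledBorromeanBraid y ≠ y := by
  refine exists_braidAct_cubicOp_ne hp hodd (k := 2)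
    ![(0, 0, 0, 0), (0, 0, 0, 0), (0, 0, 0, 0), (1, 0, 0, 0), (0, 1, 0, 0), (0, 0, 1, 0)] 0 ?_
  rw [braidAct_doubledBorromeanBraid]
  simp only [Function.iterate_succ_apply, Function.iterate_zero, id,
    braidAct_doubledBorromeanBraid_factor]
  norm_num [cubicOp]

theorem theorem5 (p : ℕ) (hp : p.Prime) (hodd : Odd p) :
    (∀ T : Link, T.IsTrivial → ¬ NMoveEquivalent p fiveBraid.closure.toLink T) ∧
      (∀ T : Link, T.IsTrivial → ¬ NMoveEquivalent p borromeanRings.twoParallel.toLink T) := by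
  have := Fact.mk hp
  rw [borromeanRings_twoParallel]
  exact ⟨not_nMoveEquivalent_of_braidAct (isKei_affineOp (ZMod p)) (isKei_cubicOp (ZMod p))
      (twistTrivial_affineOp p) (twistTrivial_cubicOp hp hodd) braidAct_fiveBraid_affineOp
      (exists_braidAct_fiveBraid_ne hp hodd),
    not_nMoveEquivalent_of_braidAct (isKei_affineOp (ZMod p)) (isKei_cubicOp (ZMod p))
      (twistTrivial_affineOp p) (twistTrivial_cubicOp hp hodd)
      braidAct_doubledBorromeanBraid_affineOp (exists_braidAct_doubledBorromeanBraid_ne hp hodd)⟩
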